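/- For a finite group $G$ let $\mathrm{Z}\ell^1(G)$ be the centre of the complex group algebra $\mathbb{C}G$ with the $\ell^1$-norm $\|f\|=\sum_{g}|f(g)|$, and let $\mathrm{AM}_Z(G)$ be its amenability constant, that is, the norm in the projective tensor product $\mathrm{Z}\ell^1(G)\mathbin{\widehat\otimes}\mathrm{Z}\ell^1(G)$ of the unique element $M$ satisfying $a\cdot M=M\cdot a$ for all $a\in \mathrm{Z}\ell^1(G)$ and $\pi(M)=1$, where $\pi$ is the product map. For a finite field $\mathbb{F}_q$ with $q$ elements let $\mathrm{Aff}(\mathbb{F}_q)$ be the group of matrices $\begin{pmatrix} a&b\\0&1\end{pmatrix}$ with $a\in\mathbb{F}_q^\times$, $b\in\mathbb{F}_q$, and write $\mathrm{Aff}(p)=\mathrm{Aff}(\mathbb{F}_p)$ for $p$ prime. 1. If $q\ge 3$ then $\mathrm{AM}_Z(\mathrm{Aff}(\mathbb{F}_q)) = 5-\frac{8}{q}$. 2. For every odd prime $p$, $2\le \mathrm{AM}_Z(\mathrm{Aff}(p))\le 5$, and $\mathrm{Aff}(p)$ has an irreducible complex character of degree $p-1$. 3. There is a sequence $(G_i)$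 of finite non-abelian groups such that the maximal degrees of irreducible complex characters of the $G_i$ are unbounded, while $\sup_i \mathrm{AM}_Z(G_i)=5$. 4. There is no non-decreasing function $f:\mathbb{N}\to\mathbb{R}$ with $f(n)\to\infty$ as $n\to\infty$ such that $\mathrm{AM}_Z(G)\ge f\bigl(\max\{d_\chi:\chi\in\mathrm{Irr}(G)\}\bigr)$ for all finite non-abelian groups $G$, where $\mathrm{Irr}(G)$ is the set of irreducible complex characters of $G$ and $d_\chi=\chi(1)$. -/

import Mathlib

open scoped TensorProduct

noncomputable section

/-- The projective tensor norm on `A ⊗ A`, where `A` carries the norm `N`: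
the infimum of `∑ N (aᵢ) N (bᵢ)` over all representations `u = ∑ aᵢ ⊗ bᵢ`. -/
def projTensorNorm {A : Type*} [Ring A] [Algebra ℂ A] (N : A → ℝ) (u : A ⊗[ℂ] A) : ℝ :=
  sInf {c : ℝ | ∃ (n : ℕ) (a b : Fin n → A),
    u = ∑ i, a i ⊗ₜ[ℂ] b i ∧ c = ∑ i, N (a i) * N (b i)}

/-- `M ∈ A ⊗ A` is a diagonal element of the unital algebra `A`: `a · M = M · a` for all `a`, where
`a · (x ⊗ y) = (a x) ⊗ y` and `(x ⊗ y) · a = x ⊗ (y a)`, and the product map `A ⊗ A → A`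
sends `M` to `1`. -/
def IsDiagonalElement {A : Type*} [Ring A] [Algebra ℂ A] (M : A ⊗[ℂ] A) : Prop :=
  (∀ a : A, (a ⊗ₜ[ℂ] (1 : A)) * M = M * ((1 : A) ⊗ₜ[ℂ] a)) ∧ LinearMap.mul' ℂ A M = 1

/-- The amenability constant of a finite-dimensional unital algebra `A` with norm `N`: the infimum
of the projective norms of the diagonal elements of `A`. If `A` is commutative and semisimple,
there is exactly one diagonal element, and this is its norm. -/
def amenabilityConstant (A : Type*) [Ring A] [Algebra ℂ A] (N : A → ℝ) : ℝ :=
  sInf {c : ℝ | ∃ M : A ⊗[ℂ] A, IsDiagonalElement M ∧ c = projTensorNorm N M}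

/-- The `ℓ¹`-norm on the group algebra `ℂG` (for `G` finite, `ℂG` with this norm is `ℓ¹(G)`,
with respect to counting measure). -/
def l1Norm {G : Type*} [Group G] (f : MonoidAlgebra ℂ G) : ℝ :=
  f.coeff.sum fun _ c => ‖c‖

/-- `AM_Z(G)`: the amenability constant of the centre of `ℓ¹(G)`, with the `ℓ¹`-norm, for a finite
group `G`. -/
def AMZ (G : Type*) [Group G] [Finite G] : ℝ :=
  amenabilityConstant (Subalgebra.center ℂ (MonoidAlgebra ℂ G))
    (fun z => l1Norm (z : MonoidAlgebra ℂ G))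

/-- The affine group of `K`: the matrices `(a b; 0 1)` with `a` a unit of `K` and `b ∈ K`,
as a subgroup of `GL₂(K)`. -/
def Aff (K : Type*) [CommRing K] : Subgroup (GL (Fin 2) K) where
  carrier := {g | ∃ (a : Kˣ) (b : K), (g : Matrix (Fin 2) (Fin 2) K) = !![(a : K), b; 0, 1]}
  one_mem' := ⟨1, 0, by simp [Matrix.one_fin_two]⟩
  mul_mem' := by
    rintro g h ⟨a, b, hg⟩ ⟨c, d, hh⟩
    exact ⟨a * c, a * d + b, by simp [hg, hh]⟩
  inv_mem' := by
    rintro g ⟨a, b, hg⟩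
    refine ⟨a⁻¹, -(((a⁻¹ : Kˣ) : K) * b), ?_⟩
    rw [Matrix.coe_units_inv, hg]
    apply Matrix.inv_eq_right_inv
    simp [Matrix.one_fin_two]

/-- The set `Irr(G)` of (complex) irreducible characters of a finite group `G`. -/
def irrChars (G : Type*) [Group G] : Set (G → ℂ) :=
  {χ | ∃ (n : ℕ) (ρ : Representation ℂ G (Fin n → ℂ)), ρ.IsIrreducible ∧ χ = ρ.character}

/-- The set of degrees `d_χ = χ(1)` of the irreducible characters of `G`. -/
def charDegrees (G : Type*) [Group G] : Set ℕ :=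
  {d | ∃ χ ∈ irrChars G, χ 1 = (d : ℂ)}

/-- The maximal degree of an irreducible character of a finite group `G`. -/
def maxCharDegree (G : Type*) [Group G] [Finite G] : ℕ :=
  sSup (charDegrees G)

end

/-! Let `π` be the determinant map from the affine group to `H = Fˣ`; its kernel, of order `n = q`,
is the translation group. The conjugacy classes are `{1}` and the fibres of `π` with `1` removed, so
the centre of the group algebra is spanned by `1` and the fibre sums `c a`, which satisfy `c a * c b
= n • c (a * b)`. Thus `c 1 / n` is an idempotent, the `c a / n` form a copy of `H`, and the centre
is `ℂ × ℂH`. With `e = 1 - c 1 / n` and `m = |H|`, its diagonal element is `M = e ⊗ e + (1 / (m n²))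
∑ c a ⊗ c a⁻¹`.

In terms of class sums, `M` has negative or zero coefficients exactly at the mixed tensors of `1`
with `d 1 = c 1 - 1`, and positive ones elsewhere. The functional `φ` that sums coefficients with
the sign at `1` reversed has norm at most one, and `φ ⊗ φ` produces just these signs. By duality the
class sum expansion is optimal (`projTensorNorm_sum_eq`), so the projective norm is a finite sum,
which is `5 - 8 / q` for `n = q`, `m = q - 1`.

Functions on `Fˣ` carry an irreducible representation of degree `q - 1`. Hence along the primes the
degrees are unbounded while the constants increase towards 5. -/

/-! ### Diagonal elements and projective norms -/

/-- A diagonal element absorbs any tensor into its product. -/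
theorem IsDiagonalElement.mul_eq {A : Type*} [CommRing A] [Algebra ℂ A] {M : A ⊗[ℂ] A}
    (hM : IsDiagonalElement M) (X : A ⊗[ℂ] A) :
    M * X = M * ((1 : A) ⊗ₜ[ℂ] LinearMap.mul' ℂ A X) := by
  induction X using TensorProduct.induction_on with
  | zero => simp
  | add x y hx hy => rw [mul_add, hx, hy, map_add, TensorProduct.tmul_add, mul_add]
  | tmul a b =>
    have h1 : a ⊗ₜ[ℂ] b = (a ⊗ₜ[ℂ] (1 : A)) * ((1 : A) ⊗ₜ[ℂ] b) := by simp
    rw [h1, ← mul_assoc, mul_comm M, hM.1 a, mul_assoc]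
    simp

/-- A commutative algebra has at most one diagonal element. -/
theorem IsDiagonalElement.unique {A : Type*} [CommRing A] [Algebra ℂ A] {M M' : A ⊗[ℂ] A}
    (hM : IsDiagonalElement M) (hM' : IsDiagonalElement M') : M = M' := by
  have h1 := hM.mul_eq M'
  have h2 := hM'.mul_eq M
  rw [hM'.2, ← Algebra.TensorProduct.one_def, mul_one] at h1
  rw [hM.2, ← Algebra.TensorProduct.one_def, mul_one] at h2
  rw [← h1, mul_comm, h2]

theorem amenabilityConstant_eq {A : Type*} [CommRing A] [Algebra ℂ A] (N : A → ℝ)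
    {M : A ⊗[ℂ] A} (hM : IsDiagonalElement M) :
    amenabilityConstant A N = projTensorNorm N M := by
  have : {c : ℝ | ∃ M : A ⊗[ℂ] A, IsDiagonalElement M ∧ c = projTensorNorm N M}
      = {projTensorNorm N M} := by
    ext c
    constructor
    · rintro ⟨M', hM', rfl⟩
      rw [hM.unique hM']
      rfl
    · rintro rfl
      exact ⟨M, hM, rfl⟩
  rw [amenabilityConstant, this, csInf_singleton]

/-- If a functional of norm at most one attains the norms in a representation of a tensor, up to
signs which cancel, then this representation is optimal. -/
theorem projTensorNorm_sum_eq {A : Type*} [Ring A] [Algebra ℂ A] (N : A → ℝ) (φ : A →ₗ[ℂ] ℂ)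
    (hφ : ∀ a, ‖φ a‖ ≤ N a) {ι : Type*} [Fintype ι] (a b : ι → A)
    (h : ∀ i, φ (a i) * φ (b i) = ((N (a i) * N (b i) : ℝ) : ℂ)) :
    projTensorNorm N (∑ i, a i ⊗ₜ[ℂ] b i) = ∑ i, N (a i) * N (b i) := by
  apply IsLeast.csInf_eq
  constructor
  · let e := Fintype.equivFin ι
    refine ⟨Fintype.card ι, fun i => a (e.symm i), fun i => b (e.symm i), ?_, ?_⟩
    · exact (e.symm.sum_comp fun i => a i ⊗ₜ[ℂ] b i).symm
    · exact (e.symm.sum_comp fun i => N (a i) * N (b i)).symm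
  · rintro c ⟨n, x, y, hxy, rfl⟩
    -- Duality: `φ ⊗ φ` does not depend on the representation of the tensor. It equals the claimed
    -- value on the given one and is bounded by the cost of any other.
    have h1 := congrArg (LinearMap.mul' ℂ ℂ ∘ₗ TensorProduct.map φ φ) hxy
    simp only [map_sum, LinearMap.comp_apply, TensorProduct.map_tmul, LinearMap.mul'_apply, h]
      at h1
    rw [← Complex.ofReal_sum] at h1
    have hN : ∀ a, 0 ≤ N a := fun a => (norm_nonneg _).trans (hφ a)
    calc ∑ i, N (a i) * N (b i) ≤ ‖((∑ i, N (a i) * N (b i) : ℝ) : ℂ)‖ := by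
          rw [Complex.norm_real]; exact le_abs_self _
      _ ≤ ∑ i, ‖φ (x i) * φ (y i)‖ := by rw [h1]; exact norm_sum_le _ _
      _ ≤ ∑ i, N (x i) * N (y i) := by
          refine Finset.sum_le_sum fun i _ => ?_
          rw [norm_mul]
          exact mul_le_mul (hφ _) (hφ _) (norm_nonneg _) (hN _)

/-! ### The centre of the group algebra and the `ℓ¹`-norm -/

namespace MonoidAlgebra

theorem mem_center_iff_coeff {G : Type*} [Group G] {x : MonoidAlgebra ℂ G} :
    x ∈ Subalgebra.center ℂ (MonoidAlgebra ℂ G) ↔ ∀ g h, IsConj g h → x.coeff g = x.coeff h := by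
  rw [Subalgebra.mem_center_iff]
  constructor
  · intro hx g h hgh
    obtain ⟨c, rfl⟩ := isConj_iff.mp hgh
    have := congrArg (fun y => y.coeff (c * g)) (hx (single c 1))
    simpa [coeff_single_mul_apply, coeff_mul_single_apply] using this
  · intro hx b
    induction b using MonoidAlgebra.induction_linear with
    | zero => simp
    | add y z hy hz => rw [add_mul, mul_add, hy, hz]
    | single g r =>
      ext h
      rw [coeff_single_mul_apply, coeff_mul_single_apply, mul_comm]
      congr 1
      exact hx _ _ (isConj_iff.mpr ⟨g, by group⟩)

end MonoidAlgebra

theorem l1Norm_eq_sum {G : Type*} [Group G] [Fintype G] (f : MonoidAlgebra ℂ G) :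
    l1Norm f = ∑ g, ‖f.coeff g‖ :=
  Finsupp.sum_fintype _ _ (by simp)

theorem l1Norm_smul {G : Type*} [Group G] [Fintype G] (c : ℂ) (f : MonoidAlgebra ℂ G) :
    l1Norm (c • f) = ‖c‖ * l1Norm f := by
  simp [l1Norm_eq_sum, Finset.mul_sum]

open Classical in
/-- The functional `f ↦ ∑ g, f g - 2 f 1` on the group algebra. -/
noncomputable def signedAugmentation (G : Type*) [Group G] [Fintype G] :
    MonoidAlgebra ℂ G →ₗ[ℂ] ℂ where
  toFun f := ∑ g, (if g = 1 then -1 else 1) * f.coeff g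
  map_add' x y := by simp [mul_add, Finset.sum_add_distrib]
  map_smul' c x := by
    simp only [MonoidAlgebra.coeff_smul_apply, smul_eq_mul, Finset.mul_sum, RingHom.id_apply]
    exact Finset.sum_congr rfl fun _ _ => by ring

theorem norm_signedAugmentation_le {G : Type*} [Group G] [Fintype G] (f : MonoidAlgebra ℂ G) :
    ‖signedAugmentation G f‖ ≤ l1Norm f := by
  rw [l1Norm_eq_sum]
  refine (norm_sum_le _ _).trans (Finset.sum_le_sum fun g _ => ?_)
  split_ifs <;> simp

theorem signedAugmentation_one {G : Type*} [Group G] [Fintype G] :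
    signedAugmentation G 1 = -1 := by
  classical
  have : ∀ g : G, (if g = 1 then -1 else 1 : ℂ) * (1 : MonoidAlgebra ℂ G).coeff g =
      if g = 1 then -1 else 0 := by
    intro g
    by_cases hg : g = 1
    · simp [hg]
    · simp [hg, MonoidAlgebra.one_def]
  exact (Finset.sum_congr rfl fun g _ => this g).trans (by simp)

theorem l1Norm_one {G : Type*} [Group G] [Fintype G] : l1Norm (1 : MonoidAlgebra ℂ G) = 1 := by
  simp [l1Norm, MonoidAlgebra.one_def]

/-! ### Fibre sums of a homomorphism to an abelian group -/

section Fibres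

variable {G H : Type*} [Group G] [Fintype G] [CommGroup H] (π : G →* H)

open Classical in
/-- The sum of the elements of a fibre of a homomorphism. -/
noncomputable def fibreSum (a : H) : MonoidAlgebra ℂ G :=
  .ofCoeff (Finsupp.equivFunOnFinite.symm fun g => if π g = a then 1 else 0)

open Classical in
/-- The sum of the nontrivial elements of a fibre of a homomorphism. -/
noncomputable def fibreSumNeOne (a : H) : MonoidAlgebra ℂ G :=
  .ofCoeff (Finsupp.equivFunOnFinite.symm fun g => if π g = a ∧ g ≠ 1 then 1 else 0)

open Classical in
theorem coeff_fibreSum (a : H) (g : G) :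
    (fibreSum π a).coeff g = if π g = a then 1 else 0 := rfl

open Classical in
theorem coeff_fibreSumNeOne (a : H) (g : G) :
    (fibreSumNeOne π a).coeff g = if π g = a ∧ g ≠ 1 then 1 else 0 := rfl

theorem IsConj.map_eq {G H : Type*} [Group G] [CommGroup H] (π : G →* H) {g h : G} (hgh : IsConj g h) : π g = π h := by
  obtain ⟨c, rfl⟩ := isConj_iff.mp hgh
  simp

theorem fibreSum_mem_center (a : H) :
    fibreSum π a ∈ Subalgebra.center ℂ (MonoidAlgebra ℂ G) := by
  rw [MonoidAlgebra.mem_center_iff_coeff]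
  intro g h hgh
  rw [coeff_fibreSum, coeff_fibreSum, hgh.map_eq π]

theorem fibreSumNeOne_mem_center (a : H) :
    fibreSumNeOne π a ∈ Subalgebra.center ℂ (MonoidAlgebra ℂ G) := by
  rw [MonoidAlgebra.mem_center_iff_coeff]
  classical
  intro g h hgh
  have h1 : g = 1 ↔ h = 1 := by
    constructor
    · rintro rfl; exact isConj_one_right.mp hgh
    · rintro rfl; exact isConj_one_left.mp hgh
  rw [coeff_fibreSumNeOne, coeff_fibreSumNeOne]
  exact if_congr (by rw [hgh.map_eq π, Ne, h1]) rfl rfl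

open Classical in
theorem fibreSum_eq_add (a : H) :
    fibreSum π a = fibreSumNeOne π a + if a = 1 then 1 else 0 := by
  ext g
  rw [MonoidAlgebra.coeff_add, Finsupp.add_apply, coeff_fibreSum, coeff_fibreSumNeOne]
  by_cases hg : g = 1
  · subst hg
    by_cases ha : a = 1
    · simp [ha]
    · simp [ha, Ne.symm ha]
  · by_cases ha : a = 1 <;> simp [ha, hg, MonoidAlgebra.one_def]

open Classical in
theorem card_fibre (hπ : Function.Surjective π) (a : H) :
    (Finset.univ.filter fun g => π g = a).card = Nat.card π.ker := by
  obtain ⟨x, rfl⟩ := hπ a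
  rw [← Fintype.card_subtype, ← Nat.card_eq_fintype_card]
  refine Nat.card_congr ⟨fun g => ⟨x⁻¹ * g, by simp [MonoidHom.mem_ker, g.2]⟩,
    fun k => ⟨x * k, by simp [MonoidHom.mem_ker.mp k.2]⟩, fun g => by simp, fun k => by simp⟩

theorem fibreSum_mul_single (a : H) (g : G) :
    fibreSum π a * MonoidAlgebra.single g 1 = fibreSum π (a * π g) := by
  classical
  ext h
  rw [MonoidAlgebra.coeff_mul_single_apply, coeff_fibreSum, coeff_fibreSum, map_mul, map_inv,
    mul_one]
  exact if_congr mul_inv_eq_iff_eq_mul rfl rfl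

open Classical in
theorem fibreSum_eq_sum (a : H) :
    fibreSum π a = ∑ g ∈ Finset.univ.filter (fun g => π g = a), MonoidAlgebra.single g 1 := by
  ext h
  rw [MonoidAlgebra.coeff_sum, Finsupp.finsetSum_apply, coeff_fibreSum,
    Finset.sum_filter, Finset.sum_eq_single h]
  · simp
  · intro g _ hg
    simp [hg]
  · simp

/-- Right translation by `g` carries the fibre over `a` onto the fibre over `a * π g`, so all
elements of the fibre over `b` contribute the same term. -/
theorem fibreSum_mul_fibreSum (hπ : Function.Surjective π) (a b : H) :
    fibreSum π a * fibreSum π b = (Nat.card π.ker : ℂ) • fibreSum π (a * b) := by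
  classical
  rw [fibreSum_eq_sum π b, Finset.mul_sum, ← card_fibre π hπ b, Nat.cast_smul_eq_nsmul,
    ← Finset.sum_const]
  refine Finset.sum_congr rfl fun g hg => ?_
  rw [fibreSum_mul_single, (Finset.mem_filter.mp hg).2]

open Classical in
theorem sum_coeff_fibreSumNeOne (hπ : Function.Surjective π) (a : H) :
    (∑ g, if π g = a ∧ g ≠ 1 then 1 else 0 : ℝ) = Nat.card π.ker - if a = 1 then 1 else 0 := by
  rw [← card_fibre π hπ a, Finset.card_filter]
  push_cast
  rw [eq_sub_iff_add_eq]
  have : (if a = 1 then 1 else 0 : ℝ) = ∑ g : G, if g = 1 then (if a = 1 then 1 else 0) else 0 := by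
    simp
  rw [this, ← Finset.sum_add_distrib]
  refine Finset.sum_congr rfl fun g _ => ?_
  by_cases hg : g = 1
  · subst hg; simp [eq_comm]
  · simp [hg]

open Classical in
theorem l1Norm_fibreSumNeOne (hπ : Function.Surjective π) (a : H) :
    l1Norm (fibreSumNeOne π a) = Nat.card π.ker - if a = 1 then 1 else 0 := by
  rw [l1Norm_eq_sum, ← sum_coeff_fibreSumNeOne π hπ a]
  refine Finset.sum_congr rfl fun g _ => ?_
  rw [coeff_fibreSumNeOne]
  split_ifs <;> simp

theorem signedAugmentation_fibreSumNeOne (a : H) :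
    signedAugmentation G (fibreSumNeOne π a) = (l1Norm (fibreSumNeOne π a) : ℝ) := by
  classical
  rw [l1Norm_eq_sum, Complex.ofReal_sum]
  refine Finset.sum_congr rfl fun g _ => ?_
  rw [coeff_fibreSumNeOne]
  by_cases hg : g = 1
  · simp [hg]
  · by_cases ha : π g = a <;> simp [hg, ha]

end Fibres

section CentralFibres

variable {G H : Type*} [Group G] [Fintype G] [CommGroup H] (π : G →* H)

/-- The sum of the elements of a fibre, as an element of the centre of the group algebra. -/
noncomputable def centralFibreSum (a : H) : Subalgebra.center ℂ (MonoidAlgebra ℂ G) :=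
  ⟨fibreSum π a, fibreSum_mem_center π a⟩

/-- The sum of the nontrivial elements of a fibre, as an element of the centre of the group
algebra. -/
noncomputable def centralFibreSumNeOne (a : H) : Subalgebra.center ℂ (MonoidAlgebra ℂ G) :=
  ⟨fibreSumNeOne π a, fibreSumNeOne_mem_center π a⟩

theorem centralFibreSum_mul (hπ : Function.Surjective π) (a b : H) :
    centralFibreSum π a * centralFibreSum π b =
      (Nat.card π.ker : ℂ) • centralFibreSum π (a * b) :=
  Subtype.ext (fibreSum_mul_fibreSum π hπ a b)

open Classical in
theorem centralFibreSum_eq_add (a : H) :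
    centralFibreSum π a = centralFibreSumNeOne π a + if a = 1 then 1 else 0 := by
  apply Subtype.ext
  have := fibreSum_eq_add π a
  by_cases ha : a = 1
  · rw [if_pos ha] at this ⊢
    exact this
  · rw [if_neg ha] at this ⊢
    rw [add_zero] at this ⊢
    exact this

/-- If the fibres of `π`, without the neutral element, are conjugacy classes, then the centre of
the group algebra is spanned by the unit and the fibre sums. -/
theorem center_eq_smul_one_add_sum [Fintype H] (hπ : Function.Surjective π)
    (hn : 2 ≤ Nat.card π.ker)
    (hc : ∀ g h, π g = π h → g ≠ 1 → h ≠ 1 → IsConj g h)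
    (z : Subalgebra.center ℂ (MonoidAlgebra ℂ G)) :
    ∃ (x : ℂ) (y : H → ℂ), z = x • 1 + ∑ a, y a • centralFibreSum π a := by
  classical
  have hs : ∀ a : H, ∃ g : G, π g = a ∧ g ≠ 1 := by
    intro a
    by_cases ha : a = 1
    · have : Nontrivial π.ker := Finite.one_lt_card_iff_nontrivial.mp hn
      obtain ⟨k, hk⟩ := exists_ne (1 : π.ker)
      exact ⟨k, by rw [ha]; exact k.2, fun h => hk (Subtype.ext h)⟩
    · obtain ⟨g, rfl⟩ := hπ a
      exact ⟨g, rfl, by rintro rfl; simp at ha⟩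
  choose s hs1 hs2 using hs
  obtain ⟨z, hz⟩ := z
  have hz' := MonoidAlgebra.mem_center_iff_coeff.mp hz
  -- Off the identity, `z` is constant on each fibre, with value read at `s a`. The fibre sum over
  -- `1` also assigns this value to the identity; the multiple of `1` corrects it.
  refine ⟨z.coeff 1 - z.coeff (s 1), fun a => z.coeff (s a), Subtype.ext ?_⟩
  ext g
  have h1 : (((∑ a, z.coeff (s a) • centralFibreSum π a :
      Subalgebra.center ℂ (MonoidAlgebra ℂ G)) : MonoidAlgebra ℂ G)).coeff g =
      z.coeff (s (π g)) := by
    rw [AddSubmonoidClass.coe_finsetSum, MonoidAlgebra.coeff_sum, Finsupp.finsetSum_apply,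
      Finset.sum_eq_single (π g)]
    · simp [centralFibreSum, coeff_fibreSum]
    · intro a _ ha
      simp [centralFibreSum, coeff_fibreSum, Ne.symm ha]
    · simp
  change _ = ((z.coeff 1 - z.coeff (s 1)) • (1 : MonoidAlgebra ℂ G) + (((∑ a, z.coeff (s a) •
    centralFibreSum π a : Subalgebra.center ℂ (MonoidAlgebra ℂ G)) : MonoidAlgebra ℂ G))).coeff g
  rw [MonoidAlgebra.coeff_add, Finsupp.add_apply, h1, MonoidAlgebra.coeff_smul_apply]
  by_cases hg : g = 1
  · subst hg
    simp
  · rw [← hz' _ _ (hc g (s (π g)) (hs1 _).symm hg (hs2 _))]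
    simp [MonoidAlgebra.one_def, hg]

end CentralFibres

/-! ### The diagonal element and its norm -/

section Diagonal

variable {A H : Type*} [CommRing A] [Algebra ℂ A] [CommGroup H] [Fintype H] (n : ℂ) (c : H → A)

/-- The diagonal element of an algebra spanned by `1` and elements `c a` with
`c a * c b = n • c (a * b)`. -/
noncomputable def groupLikeDiagonal : A ⊗[ℂ] A :=
  (1 - n⁻¹ • c 1) ⊗ₜ[ℂ] (1 - n⁻¹ • c 1) +
  ((Nat.card H : ℂ)⁻¹ * (n⁻¹ * n⁻¹)) • ∑ a, c a ⊗ₜ[ℂ] c a⁻¹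

/-- The two summands are the diagonal elements of the factors of `A` cut out by the idempotents `1 -
n⁻¹ • c 1` and `n⁻¹ • c 1`; the second is the usual group algebra diagonal, averaged over `H`. -/
theorem isDiagonalElement_groupLikeDiagonal (hn : n ≠ 0)
    (hmul : ∀ a b, c a * c b = n • c (a * b))
    (hspan : ∀ z, ∃ (x : ℂ) (y : H → ℂ), z = x • 1 + ∑ a, y a • c a) :
    IsDiagonalElement (groupLikeDiagonal n c) := by
  have hm : (Nat.card H : ℂ) ≠ 0 := by exact_mod_cast Nat.card_pos.ne'
  -- `n⁻¹ • c 1` acts as an identity on every `c b`.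
  have hp : ∀ b, c b * (1 - n⁻¹ • c 1) = 0 := by
    intro b
    rw [mul_sub, mul_one, mul_smul_comm, hmul, smul_smul, inv_mul_cancel₀ hn, one_smul, mul_one,
      sub_self]
  constructor
  · have key : ∀ b : H, (c b ⊗ₜ[ℂ] 1) * groupLikeDiagonal n c =
        (1 ⊗ₜ[ℂ] c b) * groupLikeDiagonal n c := by
      intro b
      rw [groupLikeDiagonal, mul_add, mul_add, mul_smul_comm, mul_smul_comm, Finset.mul_sum,
        Finset.mul_sum]
      simp only [Algebra.TensorProduct.tmul_mul_tmul, one_mul, hp, TensorProduct.zero_tmul,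
        TensorProduct.tmul_zero, hmul, zero_add, ← TensorProduct.smul_tmul',
        TensorProduct.tmul_smul]
      congr 1
      rw [← Equiv.sum_comp (Equiv.mulLeft b) (fun a => n • (c a ⊗ₜ[ℂ] c (b * a⁻¹)))]
      simp
    intro a
    rw [mul_comm (groupLikeDiagonal n c)]
    obtain ⟨x, y, rfl⟩ := hspan a
    rw [TensorProduct.add_tmul, TensorProduct.tmul_add, TensorProduct.sum_tmul,
      TensorProduct.tmul_sum, add_mul, add_mul, Finset.sum_mul, Finset.sum_mul]
    congr 1
    · rw [TensorProduct.smul_tmul]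
    · refine Finset.sum_congr rfl fun b _ => ?_
      rw [← TensorProduct.smul_tmul', TensorProduct.tmul_smul, smul_mul_assoc, smul_mul_assoc, key]
  · rw [groupLikeDiagonal, map_add, map_smul, map_sum]
    simp only [LinearMap.mul'_apply, hmul, mul_inv_cancel, Finset.sum_const,
      Finset.card_univ, ← Nat.card_eq_fintype_card]
    rw [sub_mul, one_mul, smul_mul_assoc, hp, smul_zero, sub_zero, ← Nat.cast_smul_eq_nsmul ℂ,
      smul_smul, smul_smul]
    have : (Nat.card H : ℂ)⁻¹ * (n⁻¹ * n⁻¹) * (Nat.card H * n) = n⁻¹ := by field_simp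
    rw [mul_assoc, this, sub_add_cancel]

/-- The expansion of the diagonal element in terms of `1` and of elements `d a` with
`c a = d a` for `a ≠ 1` and `c 1 = d 1 + 1`. -/
theorem groupLikeDiagonal_eq_sum [DecidableEq H] (hn : n ≠ 0) (d : H → A)
    (hd : ∀ a, c a = d a + if a = 1 then 1 else 0) :
    groupLikeDiagonal n c = ∑ i : Fin 4 ⊕ H,
      (Sum.elim
        ![(((n - 1) ^ 2 + (Nat.card H : ℂ)⁻¹) * (n⁻¹ * n⁻¹)) • (1 : A),
          (((Nat.card H : ℂ)⁻¹ - (n - 1)) * (n⁻¹ * n⁻¹)) • (1 : A),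
          (((Nat.card H : ℂ)⁻¹ - (n - 1)) * (n⁻¹ * n⁻¹)) • d 1,
          (n⁻¹ * n⁻¹) • d 1]
        (fun a => ((Nat.card H : ℂ)⁻¹ * (n⁻¹ * n⁻¹)) • d a) i) ⊗ₜ[ℂ]
      (Sum.elim ![1, d 1, 1, d 1] (fun a => d a⁻¹) i) := by
  have h1 : ∑ a, c a ⊗ₜ[ℂ] c a⁻¹ = ∑ a, d a ⊗ₜ[ℂ] d a⁻¹ + 1 ⊗ₜ[ℂ] d 1 + d 1 ⊗ₜ[ℂ] 1 +
      1 ⊗ₜ[ℂ] 1 := by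
    have : ∀ a, c a ⊗ₜ[ℂ] c a⁻¹ = d a ⊗ₜ[ℂ] d a⁻¹ +
        if a = 1 then (1 : A) ⊗ₜ[ℂ] d 1 + d 1 ⊗ₜ[ℂ] (1 : A) + (1 : A) ⊗ₜ[ℂ] (1 : A) else 0 := by
      intro a
      by_cases ha : a = 1
      · subst ha
        simp only [hd, inv_one, if_true, TensorProduct.add_tmul, TensorProduct.tmul_add]
        abel
      · simp [hd, ha]
    rw [Finset.sum_congr rfl fun a _ => this a, Finset.sum_add_distrib, Finset.sum_ite_eq']
    simp only [Finset.mem_univ, if_true]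
    abel
  have h2 : (1 : A) - n⁻¹ • c 1 = n⁻¹ • ((n - 1) • (1 : A) - d 1) := by
    rw [hd, if_pos rfl, smul_add, smul_sub, smul_smul, mul_sub, inv_mul_cancel₀ hn, sub_smul,
      one_smul, mul_one]
    abel
  rw [groupLikeDiagonal, h1, h2, Fintype.sum_sum_type, Fin.sum_univ_four]
  simp only [Sum.elim_inl, Sum.elim_inr, Matrix.cons_val]
  simp only [← TensorProduct.smul_tmul', TensorProduct.tmul_smul, TensorProduct.sub_tmul,
    TensorProduct.tmul_sub, ← Finset.smul_sum]
  module

end Diagonal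

/-- The amenability constant of an algebra spanned by `1` and elements `c a` with
`c a * c b = n • c (a * b)`, for a suitable norm. -/
theorem amenabilityConstant_eq_of_groupLike {A H : Type*} [CommRing A] [Algebra ℂ A]
    [CommGroup H] [Fintype H] [DecidableEq H] (n : ℝ) (hn : 2 ≤ n) (c d : H → A)
    (hmul : ∀ a b, c a * c b = (n : ℂ) • c (a * b))
    (hspan : ∀ z, ∃ (x : ℂ) (y : H → ℂ), z = x • 1 + ∑ a, y a • c a)
    (hd : ∀ a, c a = d a + if a = 1 then 1 else 0)
    (N : A → ℝ) (φ : A →ₗ[ℂ] ℂ) (hφ : ∀ a, ‖φ a‖ ≤ N a) (hN : ∀ (k : ℂ) a, N (k • a) = ‖k‖ * N a)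
    (hN1 : N 1 = 1) (hφ1 : φ 1 = -1) (hNd : ∀ a, N (d a) = n - if a = 1 then 1 else 0)
    (hφd : ∀ a, φ (d a) = (N (d a) : ℂ)) :
    amenabilityConstant A N = (2 * (n - 1) / n) ^ 2 +
      ((n - 2) ^ 2 + (Nat.card H - 1) * n ^ 2) / (Nat.card H * n ^ 2) := by
  have hn0 : (n : ℂ) ≠ 0 := by
    have : n ≠ 0 := by linarith
    exact_mod_cast this
  have hm : (1 : ℝ) ≤ Nat.card H := by exact_mod_cast Nat.card_pos
  have hm1 : (Nat.card H : ℝ)⁻¹ ≤ 1 := inv_le_one_of_one_le₀ hm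
  set m : ℝ := (Nat.card H : ℝ) with hmdef
  have hmC : (Nat.card H : ℂ) = (m : ℂ) := by simp [hmdef]
  have hnn : 0 ≤ n⁻¹ * n⁻¹ := by positivity
  have hk1 : ‖(((n : ℂ) - 1) ^ 2 + (m : ℂ)⁻¹) * ((n : ℂ)⁻¹ * (n : ℂ)⁻¹)‖ =
      ((n - 1) ^ 2 + m⁻¹) * (n⁻¹ * n⁻¹) := by
    rw [← Real.norm_of_nonneg (r := ((n - 1) ^ 2 + m⁻¹) * (n⁻¹ * n⁻¹)) (by positivity),
      ← Complex.norm_real]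
    push_cast; rfl
  -- Here `m⁻¹ ≤ 1 ≤ n - 1`, so the mixed coefficient is at most zero and its norm is its negative.
  -- This is where `2 ≤ n` matters.
  have hk2 : ‖((m : ℂ)⁻¹ - ((n : ℂ) - 1)) * ((n : ℂ)⁻¹ * (n : ℂ)⁻¹)‖ =
      ((n - 1) - m⁻¹) * (n⁻¹ * n⁻¹) := by
    rw [← Real.norm_of_nonneg (r := ((n - 1) - m⁻¹) * (n⁻¹ * n⁻¹))
      (mul_nonneg (by linarith) hnn), ← Complex.norm_real, ← norm_neg]
    push_cast; congr 1; ring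
  have hk3 : ‖(n : ℂ)⁻¹ * (n : ℂ)⁻¹‖ = n⁻¹ * n⁻¹ := by
    rw [← Real.norm_of_nonneg hnn, ← Complex.norm_real]
    push_cast; rfl
  have hk4 : ‖(m : ℂ)⁻¹ * ((n : ℂ)⁻¹ * (n : ℂ)⁻¹)‖ = m⁻¹ * (n⁻¹ * n⁻¹) := by
    rw [← Real.norm_of_nonneg (r := m⁻¹ * (n⁻¹ * n⁻¹)) (by positivity), ← Complex.norm_real]
    push_cast; rfl
  rw [amenabilityConstant_eq N (isDiagonalElement_groupLikeDiagonal (n : ℂ) c hn0 hmul hspan),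
    groupLikeDiagonal_eq_sum (n : ℂ) c hn0 d hd, hmC, projTensorNorm_sum_eq N φ hφ]
  · rw [Fintype.sum_sum_type, Fin.sum_univ_four]
    simp only [Sum.elim_inl, Sum.elim_inr, Matrix.cons_val, hN, hN1, hNd, if_true, hk1, hk2, hk3,
      hk4, inv_eq_one]
    have : ∀ a : H, m⁻¹ * (n⁻¹ * n⁻¹) * (n - if a = 1 then 1 else 0) *
        (n - if a = 1 then 1 else 0) = m⁻¹ + if a = 1 then
          m⁻¹ * (n⁻¹ * n⁻¹) * (n - 1) ^ 2 - m⁻¹ else 0 := by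
      intro a
      have : n ≠ 0 := by linarith
      split_ifs
      · ring
      · field_simp; ring
    rw [Finset.sum_congr rfl fun a _ => this a, Finset.sum_add_distrib, Finset.sum_ite_eq',
      if_pos (Finset.mem_univ _), Finset.sum_const, Finset.card_univ, ← Nat.card_eq_fintype_card,
      nsmul_eq_mul, ← hmdef]
    have : n ≠ 0 := by linarith
    have : m ≠ 0 := by linarith
    field_simp
    ring
  -- Sign check: the mixed terms have a nonpositive coefficient and exactly one factor `φ 1 = -1`;
  -- the `1 ⊗ 1` term has two such factors, the others none.
  · rintro (i | a)
    · fin_cases i <;>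
        simp only [Sum.elim_inl, Fin.zero_eta, Fin.mk_one, Fin.reduceFinMk, Matrix.cons_val,
          map_smul, smul_eq_mul, hN, hN1, hφ1, hφd, hk1, hk2, hk3] <;>
        push_cast <;> ring
    · simp only [Sum.elim_inr, map_smul, smul_eq_mul, hN, hφd, hk4]
      push_cast
      ring

theorem AMZ_eq_of_fibres_isConj {G H : Type*} [Group G] [Finite G] [CommGroup H] (π : G →* H)
    (hπ : Function.Surjective π) (hn : 2 ≤ Nat.card π.ker)
    (hc : ∀ g h, π g = π h → g ≠ 1 → h ≠ 1 → IsConj g h) :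
    AMZ G = (2 * ((Nat.card π.ker : ℝ) - 1) / Nat.card π.ker) ^ 2 +
      (((Nat.card π.ker : ℝ) - 2) ^ 2 + (Nat.card H - 1) * (Nat.card π.ker : ℝ) ^ 2) /
        (Nat.card H * (Nat.card π.ker : ℝ) ^ 2) := by
  classical
  have := Fintype.ofFinite G
  have : Finite H := Finite.of_surjective π hπ
  have := Fintype.ofFinite H
  refine amenabilityConstant_eq_of_groupLike (Nat.card π.ker : ℝ) (by exact_mod_cast hn)
    (centralFibreSum π) (centralFibreSumNeOne π) ?_ (center_eq_smul_one_add_sum π hπ hn hc)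
    (fun a => by rw [centralFibreSum_eq_add]) _
    (signedAugmentation G ∘ₗ (Subalgebra.center ℂ (MonoidAlgebra ℂ G)).val.toLinearMap)
    (fun a => norm_signedAugmentation_le _) (fun k a => l1Norm_smul k _) l1Norm_one
    signedAugmentation_one (fun a => ?_) (fun a => signedAugmentation_fibreSumNeOne π a)
  · intro a b
    rw [Complex.ofReal_natCast, centralFibreSum_mul π hπ]
  · refine (l1Norm_fibreSumNeOne π hπ a).trans ?_
    congr

/-! ### Conjugacy in the affine group -/

namespace Aff

variable {F : Type*} [Field F]

/-- The linear part of an affine transformation. -/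
noncomputable def linearPart (F : Type*) [Field F] : Aff F →* Fˣ :=
  Matrix.GeneralLinearGroup.det.comp (Aff F).subtype

/-- The translation part of an affine transformation. -/
def translationPart (g : Aff F) : F := (g : GL (Fin 2) F).1 0 1

/-- The affine transformation `x ↦ a x + b`. -/
noncomputable def mk (a : Fˣ) (b : F) : Aff F :=
  ⟨Matrix.GeneralLinearGroup.mkOfDetNeZero !![(a : F), b; 0, 1] (by simp), a, b, rfl⟩

theorem coe_eq (g : Aff F) :
    (g : GL (Fin 2) F).1 = !![(linearPart F g : F), translationPart g; 0, 1] := by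
  obtain ⟨g, a, b, hg⟩ := g
  have h1 : (linearPart F ⟨g, a, b, hg⟩ : F) = a := by
    change g.1.det = a
    rw [hg]
    simp
  have h2 : translationPart ⟨g, a, b, hg⟩ = b := by
    change g.1 0 1 = b
    rw [hg]
    simp
  rw [h1, h2]
  exact hg

theorem ext_parts {g h : Aff F} (h1 : linearPart F g = linearPart F h)
    (h2 : translationPart g = translationPart h) : g = h := by
  apply Subtype.ext
  apply Units.ext
  rw [coe_eq, coe_eq, h1, h2]

@[simp] theorem linearPart_mk (a : Fˣ) (b : F) : linearPart F (mk a b) = a := by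
  apply Units.ext
  change Matrix.det !![(a : F), b; 0, 1] = a
  simp

@[simp] theorem translationPart_mk (a : Fˣ) (b : F) : translationPart (mk a b) = b := rfl

@[simp] theorem translationPart_one : translationPart (1 : Aff F) = 0 := by
  simp [translationPart]

theorem translationPart_mul (g h : Aff F) : translationPart (g * h) =
    linearPart F g * translationPart h + translationPart g := by
  change ((g : GL (Fin 2) F).1 * (h : GL (Fin 2) F).1) 0 1 = _
  rw [coe_eq, coe_eq]
  simp

theorem linearPart_surjective : Function.Surjective (linearPart F) :=
  fun a => ⟨mk a 0, linearPart_mk a 0⟩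

theorem card_ker_linearPart : Nat.card (linearPart F).ker = Nat.card F := by
  refine Nat.card_congr ⟨fun g => translationPart g.1,
    fun b => ⟨mk 1 b, by simp [MonoidHom.mem_ker]⟩, fun g => ?_, fun b => by simp⟩
  apply Subtype.ext
  apply ext_parts
  · rw [linearPart_mk, MonoidHom.mem_ker.mp g.2]
  · simp

theorem isConj_of_linearPart_eq {g h : Aff F} (hgh : linearPart F g = linearPart F h)
    (hg : g ≠ 1) (hh : h ≠ 1) : IsConj g h := by
  have key : ∀ (a : Fˣ) (b : F), (a : F) * translationPart g + b =
      linearPart F h * b + translationPart h → IsConj g h := by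
    intro a b hab
    refine isConj_iff.mpr ⟨mk a b, ?_⟩
    -- Written as `mk a b * g = h * mk a b`, the linear parts agree by commutativity, and the
    -- translation parts give the hypothesis on `a` and `b`.
    rw [mul_inv_eq_iff_eq_mul]
    apply ext_parts
    · rw [map_mul, map_mul, hgh, mul_comm]
    · simpa [translationPart_mul] using hab
  by_cases h1 : linearPart F h = 1
  · have hg' : translationPart g ≠ 0 := fun h0 => hg (ext_parts (by rw [hgh, h1, map_one])
      (by rw [h0, translationPart_one]))
    have hh' : translationPart h ≠ 0 := fun h0 => hh (ext_parts (by rw [h1, map_one])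
      (by rw [h0, translationPart_one]))
    -- Two nontrivial translations are conjugate by a scaling.
    refine key (Units.mk0 (translationPart h / translationPart g) (div_ne_zero hh' hg')) 0 ?_
    simp [hg']
  · have h2 : (1 : F) - linearPart F h ≠ 0 := by
      rw [sub_ne_zero]
      exact fun h3 => h1 (Units.ext h3.symm)
    -- With linear part other than `1` there is a unique fixed point, and a translation moves one
    -- fixed point to the other.
    refine key 1 ((translationPart h - translationPart g) / (1 - linearPart F h)) ?_
    field_simp
    push_cast
    ring

theorem AMZ_eq [Finite F] (hq : 3 ≤ Nat.card F) :
    AMZ (Aff F) = 5 - 8 / (Nat.card F : ℝ) := by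
  have := Fintype.ofFinite F
  have hu : (Nat.card Fˣ : ℝ) = Nat.card F - 1 := by
    rw [Nat.card_units, Nat.cast_sub (by omega), Nat.cast_one]
  have h3 : (3 : ℝ) ≤ Nat.card F := by exact_mod_cast hq
  rw [AMZ_eq_of_fibres_isConj (linearPart F) linearPart_surjective
    (by rw [card_ker_linearPart]; omega) (fun g h h1 h2 h3 => isConj_of_linearPart_eq h1 h2 h3),
    card_ker_linearPart, hu]
  have h1 : (Nat.card F : ℝ) ≠ 0 := by linarith
  have h2 : (Nat.card F : ℝ) - 1 ≠ 0 := by linarith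
  field_simp
  ring

theorem exists_mul_ne_mul (hq : 3 ≤ Nat.card F) : ∃ x y : Aff F, x * y ≠ y * x := by
  have : Finite F := Nat.finite_of_card_ne_zero (by omega)
  have : Nontrivial Fˣ := by
    rw [← Finite.one_lt_card_iff_nontrivial, Nat.card_units]
    omega
  obtain ⟨a, ha⟩ := exists_ne (1 : Fˣ)
  refine ⟨mk a 0, mk 1 1, fun h => ha (Units.ext ?_)⟩
  simpa [translationPart_mul] using congrArg translationPart h

/-! ### An irreducible representation of degree `q - 1` -/

/-- The representation of the affine group on functions on the units of `F` (indexed by `ι`)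
in which translations act through the additive character `ψ`. -/
noncomputable def charRep {ι : Type*} (e : ι ≃ Fˣ) (ψ : AddChar F ℂ) :
    Representation ℂ (Aff F) (ι → ℂ) where
  toFun g :=
    { toFun := fun f i => ψ (translationPart g * e i) * f (e.symm (e i * linearPart F g))
      map_add' := fun f f' => by ext; simp [mul_add]
      map_smul' := fun c f => by ext; simp [mul_left_comm] }
  map_one' := by ext; simp
  map_mul' g h := by
    refine LinearMap.ext fun f => funext fun i => ?_
    simp only [LinearMap.coe_mk, AddHom.coe_mk, Module.End.mul_apply, translationPart_mul,
      Equiv.apply_symm_apply, map_mul, Units.val_mul]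
    rw [← mul_assoc (ψ _), ← AddChar.map_add_eq_mul, ← mul_assoc (e i)]
    congr 2
    ring

theorem charRep_apply {ι : Type*} (e : ι ≃ Fˣ) (ψ : AddChar F ℂ) (g : Aff F) (f : ι → ℂ) (i : ι) :
    charRep e ψ g f i = ψ (translationPart g * e i) * f (e.symm (e i * linearPart F g)) := rfl

/-- Translations act diagonally through the characters `b ↦ ψ (b * u)`, distinct for distinct units
`u`, so an invariant subspace is spanned by delta functions. The scalings permute these
transitively. -/
theorem charRep_isIrreducible [Finite F] {ι : Type*} [Fintype ι] (e : ι ≃ Fˣ) {ψ : AddChar F ℂ}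
    (hψ : ψ.IsPrimitive) : (charRep e ψ).IsIrreducible := by
  classical
  have := Fintype.ofFinite F
  have single_mem : ∀ (S : Subrepresentation (charRep e ψ)) (f : ι → ℂ), f ∈ S.toSubmodule →
      ∀ i, f i ≠ 0 → Pi.single i 1 ∈ S.toSubmodule := by
    intro S f hf i hi
    -- Orthogonality of characters: this average over the translations is a multiple of the
    -- projection to the `i`-th coordinate.
    have h1 : ∑ b : F, ψ (-(b * e i)) • charRep e ψ (mk 1 b) f =
        ((Fintype.card F : ℂ) * f i) • Pi.single i 1 := by
      ext j
      have : ∀ b : F, (ψ (-(b * e i)) • charRep e ψ (mk 1 b) f) j =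
          ψ (b * (e j - e i)) * f j := by
        intro b
        rw [Pi.smul_apply, charRep_apply, smul_eq_mul, ← mul_assoc, ← AddChar.map_add_eq_mul]
        simp only [linearPart_mk, translationPart_mk, mul_one, Equiv.symm_apply_apply]
        congr 2
        ring
      rw [Finset.sum_apply, Finset.sum_congr rfl fun b _ => this b, ← Finset.sum_mul,
        AddChar.sum_mulShift _ hψ]
      by_cases hij : j = i
      · subst hij
        simp
      · have : (e j : F) - e i ≠ 0 := by
          rw [sub_ne_zero]
          exact fun h => hij (e.injective (Units.ext h))
        simp [this, hij]
    have h2 : ((Fintype.card F : ℂ) * f i) • (Pi.single i 1 : ι → ℂ) ∈ S.toSubmodule := by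
      rw [← h1]
      exact Submodule.sum_mem _ fun b _ =>
        Submodule.smul_mem _ _ (S.apply_mem_toSubmodule _ hf)
    exact (Submodule.smul_mem_iff _ (mul_ne_zero (by simp) hi)).mp h2
  refine { exists_pair_ne := ⟨⊥, ⊤, fun h => ?_⟩, eq_bot_or_eq_top := fun S => ?_ }
  · have h1 : (⊥ : Submodule ℂ (ι → ℂ)) = ⊤ := congrArg Subrepresentation.toSubmodule h
    have : (Pi.single (e.symm 1) 1 : ι → ℂ) ∈ (⊥ : Submodule ℂ (ι → ℂ)) := by rw [h1]; trivial
    simp at this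
  · rw [or_iff_not_imp_left]
    intro hS
    have hS' : S.toSubmodule ≠ ⊥ := fun h => hS (Subrepresentation.toSubmodule_injective h)
    obtain ⟨f, hf, hf0⟩ := (Submodule.ne_bot_iff _).mp hS'
    obtain ⟨i, hi⟩ := Function.ne_iff.mp hf0
    have h1 := single_mem S f hf i hi
    have h2 : ∀ j, (Pi.single j 1 : ι → ℂ) ∈ S.toSubmodule := by
      intro j
      refine single_mem S _ (S.apply_mem_toSubmodule (mk ((e j)⁻¹ * e i) 0) h1) j ?_
      simp [charRep_apply]
    apply Subrepresentation.toSubmodule_injective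
    refine (Submodule.eq_top_iff').mpr fun f => ?_
    rw [pi_eq_sum_univ' f]
    exact Submodule.sum_mem _ fun j _ => Submodule.smul_mem _ _ (by convert h2 j using 1)

theorem sub_one_mem_charDegrees (p : ℕ) [Fact p.Prime] : p - 1 ∈ charDegrees (Aff (ZMod p)) := by
  have hc : Fintype.card (ZMod p)ˣ = p - 1 := ZMod.card_units p
  let e : Fin (p - 1) ≃ (ZMod p)ˣ := (Fintype.equivFinOfCardEq hc).symm
  refine ⟨_, ⟨p - 1, charRep e ZMod.stdAddChar,
    charRep_isIrreducible e (ZMod.isPrimitive_stdAddChar p), rfl⟩, ?_⟩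
  rw [Representation.char_one]
  simp

end Aff

/-! ### Boundedness of character degrees -/

/-- The orbit of a nonzero vector spans an invariant subspace, hence everything. -/
theorem Representation.IsIrreducible.finrank_le_card {G V : Type*} [Group G] [Finite G]
    [AddCommGroup V] [Module ℂ V] {ρ : Representation ℂ G V} (hρ : ρ.IsIrreducible) :
    Module.finrank ℂ V ≤ Nat.card G := by
  have := Fintype.ofFinite G
  have hne : (⊤ : Submodule ℂ V) ≠ ⊥ := fun h =>
    hρ.exists_pair_ne.elim fun x ⟨y, hxy⟩ => hxy (by
      have : Subsingleton (Submodule ℂ V) := subsingleton_of_bot_eq_top h.symm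
      exact Subrepresentation.toSubmodule_injective (Subsingleton.elim _ _))
  obtain ⟨v, -, hv⟩ := (Submodule.ne_bot_iff _).mp hne
  let S : Subrepresentation ρ :=
    { toSubmodule := Submodule.span ℂ (Set.range fun g => ρ g v)
      apply_mem_toSubmodule := fun g w hw => by
        induction hw using Submodule.span_induction with
        | mem x hx =>
          obtain ⟨h, rfl⟩ := hx
          exact Submodule.subset_span ⟨g * h, by simp⟩
        | zero => simp
        | add x y _ _ hx hy => rw [map_add]; exact Submodule.add_mem _ hx hy
        | smul c x _ hx => rw [map_smul]; exact Submodule.smul_mem _ _ hx }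
  have hS : S ≠ ⊥ := fun h => hv (by
    have h1 : v ∈ S.toSubmodule := Submodule.subset_span ⟨1, by simp⟩
    rw [h] at h1
    exact h1)
  have hS' : Submodule.span ℂ (Set.range fun g => ρ g v) = ⊤ :=
    congrArg Subrepresentation.toSubmodule ((hρ.eq_bot_or_eq_top S).resolve_left hS)
  rw [← finrank_top ℂ V, ← hS', Nat.card_eq_fintype_card]
  exact finrank_range_le_card _

/-- The supremum in ℕ of an unbounded set would be `0`; the crude bound by the group order rules
this out. -/
theorem le_maxCharDegree {G : Type*} [Group G] [Finite G] {d : ℕ} (hd : d ∈ charDegrees G) :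
    d ≤ maxCharDegree G := by
  refine le_csSup ⟨Nat.card G, ?_⟩ hd
  rintro d ⟨_, ⟨n, ρ, hρ, rfl⟩, hd⟩
  rw [Representation.char_one, Nat.cast_inj] at hd
  exact hd ▸ hρ.finrank_le_card

/-! ### The main theorem -/

theorem mainTheorem7 :
    -- the exact value for finite fields with at least three elements
    (∀ (F : Type*) [Field F] [Finite F], 3 ≤ Nat.card F →
      AMZ (Aff F) = 5 - 8 / (Nat.card F : ℝ)) ∧
    -- bounds and the degree `p - 1` for odd primes `p`
    (∀ p : ℕ, ∀ [Fact p.Prime], Odd p →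
      2 ≤ AMZ (Aff (ZMod p)) ∧ AMZ (Aff (ZMod p)) ≤ 5 ∧ p - 1 ∈ charDegrees (Aff (ZMod p))) ∧
    -- a sequence of finite non-abelian groups with maximal character degrees unbounded
    -- and supremum of the amenability constants equal to 5
    (∃ (G : ℕ → Type) (_ : ∀ i, Group (G i)) (_ : ∀ i, Finite (G i)),
      (∀ i, ∃ x y : G i, x * y ≠ y * x) ∧
      (∀ N : ℕ, ∃ i, N ≤ maxCharDegree (G i)) ∧
      IsLUB (Set.range fun i => AMZ (G i)) 5) ∧
    -- no increasing unbounded function of the maximal degree is a lower bound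
    (¬ ∃ f : ℕ → ℝ, Monotone f ∧ Filter.Tendsto f Filter.atTop Filter.atTop ∧
      ∀ (G : Type) [Group G] [Finite G], (∃ x y : G, x * y ≠ y * x) →
        f (maxCharDegree G) ≤ AMZ G) := by
  have hAMZ : ∀ (p : ℕ) [Fact p.Prime], 3 ≤ p → AMZ (Aff (ZMod p)) = 5 - 8 / (p : ℝ) := by
    intro p _ hp
    have := Aff.AMZ_eq (F := ZMod p) (by rwa [Nat.card_zmod])
    rwa [Nat.card_zmod] at this
  have hle : ∀ (p : ℕ) [Fact p.Prime], 3 ≤ p → AMZ (Aff (ZMod p)) ≤ 5 := by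
    intro p _ hp
    rw [hAMZ p hp, sub_le_self_iff]
    positivity
  have hne : ∀ (p : ℕ) [Fact p.Prime], 3 ≤ p → ∃ x y : Aff (ZMod p), x * y ≠ y * x :=
    fun p _ hp => Aff.exists_mul_ne_mul (by rwa [Nat.card_zmod])
  refine ⟨fun F _ _ hF => Aff.AMZ_eq hF, fun p hp hodd => ?_, ?_, ?_⟩
  · have h3 : 3 ≤ p := by
      have := hp.out.two_le
      obtain ⟨k, hk⟩ := hodd
      omega
    refine ⟨?_, hle p h3, Aff.sub_one_mem_charDegrees p⟩
    have h3' : (3 : ℝ) ≤ p := by exact_mod_cast h3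
    have : (8 : ℝ) / p ≤ 3 := by
      rw [div_le_iff₀ (by linarith)]
      linarith
    rw [hAMZ p h3]
    linarith
  -- The shift by 3 gives `3 ≤ p i` as well as `i ≤ p i - 1`, the degree needed for unboundedness.
  · choose p hpi hp using fun i : ℕ => Nat.exists_infinite_primes (i + 3)
    have : ∀ i, Fact (p i).Prime := fun i => ⟨hp i⟩
    have h3 : ∀ i, 3 ≤ p i := fun i => by have := hpi i; omega
    refine ⟨fun i => Aff (ZMod (p i)), fun i => inferInstance, fun i => inferInstance,
      fun i => hne (p i) (h3 i), fun N => ⟨N, ?_⟩, ?_, ?_⟩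
    · refine le_trans ?_ (le_maxCharDegree (Aff.sub_one_mem_charDegrees (p N)))
      have := hpi N
      omega
    · rintro _ ⟨i, rfl⟩
      exact hle (p i) (h3 i)
    · intro c hc
      refine le_of_forall_pos_sub_le fun ε hε => ?_
      obtain ⟨i, hi⟩ := exists_nat_gt (8 / ε)
      have h1 : AMZ (Aff (ZMod (p i))) ≤ c := hc ⟨i, rfl⟩
      rw [hAMZ (p i) (h3 i)] at h1
      have h2 : (i : ℝ) ≤ p i := by
        have := hpi i
        exact_mod_cast (by omega : i ≤ p i)
      have h4 : (0 : ℝ) < p i := by exact_mod_cast (hp i).pos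
      have h5 : 8 / (p i : ℝ) ≤ ε := by
        rw [div_le_iff₀ h4]
        rw [div_lt_iff₀ hε] at hi
        nlinarith
      linarith
  · rintro ⟨f, hf, hlim, h⟩
    obtain ⟨N, hN⟩ := (hlim.eventually_gt_atTop 5).exists
    obtain ⟨p, hpN, hp⟩ := Nat.exists_infinite_primes (N + 3)
    have : Fact p.Prime := ⟨hp⟩
    have h3 : 3 ≤ p := by omega
    have h1 : N ≤ maxCharDegree (Aff (ZMod p)) :=
      le_trans (by omega) (le_maxCharDegree (Aff.sub_one_mem_charDegrees p))
    -- `5 < f N ≤ f (maxCharDegree _) ≤ AMZ _ ≤ 5` is a contradiction.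
    linarith [hf h1, h (Aff (ZMod p)) (hne p h3), hle p h3]
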